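/- Let $\mathbb{F}$ be an algebraically closed field of characteristic different from $2$, let $A$ be a finite dimensional associative (not necessarily unital) algebra over $\mathbb{F}$, and let $I$ be a two-sided ideal of $A$. Regard $I$ as an associative algebra, let $\operatorname{rad} I$ be its radical (its largest nilpotent ideal), and let $L=[I,I]$ be the linear span of all commutators $[x,y]=xy-yx$ with $x,y\in I$. An inner ideal of $L$ is a subspace $B\subseteq L$ with $[B,[B,L]]\subseteq B$; it is called Jordan-Lie (J-Lie) if $B^2=0$. Write $\bar V$ for the image of a subspace $V\subseteq L$ in $L/(L\cap\operatorname{rad} I)$. An inner ideal $B$ of $L$ is called bar-minimal if every inner ideal $B'$ of $L$ with $B'\subseteq B$ and $\bar B'=\bar B$ satisfies $B'=B$. Let $B$ be a bar-minimal Jordan-Lie inner ideal of $L=[I,I]$. Then there exist idempotents $e,f\in A$ (possibly zero) such that 1. $ef=fe=0$ (the pair $(e,f)$ is orthogonal); 2. for every simple component $S$ of the semisimple algebra $A/\operatorname{rad} A$, the projections to $S$ of the images of $e$ and $f$ in $A/\operatorname{rad} A$ are either both zero or both non-zero (the pair $(e,f)$ is strict); 3. $B=eAf=eIf$. -/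

import Mathlib

/-! Algebras are associative, not necessarily unital: an algebra over a field `F` is a
`NonUnitalRing A` with `Module F A`, `IsScalarTower F A A` and `SMulCommClass F A A`. -/

namespace JLie

section Rings

variable {A : Type*} [NonUnitalRing A]

/-- The set of all products `x₀ * (x₁ * (⋯ * xₙ))` of `n + 1` elements of `J`. -/
def products (J : Set A) : ℕ → Set A
  | 0 => J
  | n + 1 => {x | ∃ a ∈ J, ∃ b ∈ products J n, x = a * b}

/-- The two-sided ideal `J` is nilpotent: for some `n`, all products of `n + 1` of its elements
vanish. -/
def IsNilpotentIdeal (J : TwoSidedIdeal A) : Prop :=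
  ∃ n : ℕ, ∀ x ∈ products (J : Set A) n, x = 0

/-- The radical of `A`: the sum of all nilpotent two-sided ideals (for a finite dimensional
algebra this is the largest nilpotent ideal, and it coincides with the Jacobson radical). -/
def radical (A : Type*) [NonUnitalRing A] : TwoSidedIdeal A :=
  sSup {J : TwoSidedIdeal A | IsNilpotentIdeal J}

/-- The quotient `Ā = A / rad A`. -/
abbrev Bar (A : Type*) [NonUnitalRing A] : Type _ :=
  (radical A).ringCon.Quotient

/-- The canonical map `A → Ā`. -/
def bar (x : A) : Bar A := (x : (radical A).ringCon.Quotient)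

/-- The simple components of a semisimple ring are its minimal nonzero two-sided ideals. -/
def IsSimpleComponent {Q : Type*} [NonUnitalRing Q] (S : TwoSidedIdeal Q) : Prop :=
  IsAtom S

/-- `s` is the projection of `x` on the simple component `S` of the semisimple ring `Q`, i.e.
the `S`-coordinate of `x` in the decomposition of `Q` as the direct sum of its simple components:
`s` lies in `S`, and `x - s` in the sum of the other simple components. -/
def IsProjection {Q : Type*} [NonUnitalRing Q] (S : TwoSidedIdeal Q) (x s : Q) : Prop :=
  s ∈ S ∧ x - s ∈ sSup {T : TwoSidedIdeal Q | IsSimpleComponent T ∧ T ≠ S}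

/-- The pair `(e, f)` of elements of `A` is strict: for every simple component `S` of `Ā`,
the projections of `ē` and `f̄` on `S` are either both zero or both nonzero. -/
def IsStrict (e f : A) : Prop :=
  ∀ S : TwoSidedIdeal (Bar A), IsSimpleComponent S →
    (IsProjection S (bar e) 0 ↔ IsProjection S (bar f) 0)

/-- `(e, f)` is an orthogonal idempotent pair. -/
def IsOrthogonalIdempotentPair (e f : A) : Prop :=
  IsIdempotentElem e ∧ IsIdempotentElem f ∧ e * f = 0 ∧ f * e = 0

end Rings

section Algebras

variable {F A : Type*} [Field F] [NonUnitalRing A] [Module F A]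

/-- `[V, V]`: the span of all commutators `⁅x, y⁆ = x * y - y * x` with `x, y ∈ V`. -/
def commutatorSpan (V : Submodule F A) : Submodule F A :=
  Submodule.span F {z | ∃ x ∈ V, ∃ y ∈ V, z = ⁅x, y⁆}

variable (F A) in
/-- `A⁽⁰⁾ = A` and `A⁽ᵏ⁺¹⁾ = [A⁽ᵏ⁾, A⁽ᵏ⁾]`, Lie algebras under the commutator. -/
def lieDerived : ℕ → Submodule F A
  | 0 => ⊤
  | k + 1 => commutatorSpan (lieDerived k)

/-- `B` is an inner ideal of the Lie algebra `L ⊆ A`: a subspace of `L` with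
`[B, [B, L]] ⊆ B`. -/
def IsInnerIdeal (L B : Submodule F A) : Prop :=
  B ≤ L ∧ ∀ b ∈ B, ∀ b' ∈ B, ∀ x ∈ L, ⁅b, ⁅b', x⁆⁆ ∈ B

/-- `B` is a Jordan-Lie inner ideal of `L`: an inner ideal with `B² = 0`. -/
def IsJordanLie (L B : Submodule F A) : Prop :=
  IsInnerIdeal L B ∧ ∀ b ∈ B, ∀ b' ∈ B, b * b' = 0

/-- The image `V̄` of the subspace `V` in `Ā = A / rad A`. -/
def barImage (V : Submodule F A) : Set (Bar A) := bar '' (V : Set A)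

/-- The inner ideal `B` of `L` is bar-minimal, i.e. `X`-minimal for `X = B̄`: every inner ideal
`B' ⊆ B` of `L` with `B̄' = B̄` equals `B`. (The image of `L` in `A / rad A` is identified with
`L / (L ∩ rad A)`.) -/
def IsBarMinimal (L B : Submodule F A) : Prop :=
  IsInnerIdeal L B ∧
    ∀ B' : Submodule F A, IsInnerIdeal L B' → B' ≤ B → barImage B' = barImage B → B' = B

variable [IsScalarTower F A A] [SMulCommClass F A A]

/-- `eVf = {e * v * f | v ∈ V}`. -/
def sandwich (e : A) (V : Submodule F A) (f : A) : Submodule F A :=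
  V.map ((LinearMap.mulRight F f).comp (LinearMap.mulLeft F e))

/-- The subalgebra `I` of `A` is a two-sided ideal. -/
def IsAlgebraIdeal (I : NonUnitalSubalgebra F A) : Prop :=
  ∀ a : A, ∀ x ∈ I, a * x ∈ I ∧ x * a ∈ I

end Algebras

end JLie

namespace JLie

section Nilpotent

variable {F R : Type*} [Field F] [NonUnitalRing R] [Module F R] [IsScalarTower F R R]
  [SMulCommClass F R R]

theorem isNilpotent_mul_swap {U : Type*} [Ring U] {a b : U} (h : IsNilpotent (a * b)) :
    IsNilpotent (b * a) := by
  obtain ⟨n, hn⟩ := h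
  refine ⟨n + 1, ?_⟩
  rw [pow_succ', mul_assoc, ← mul_pow_mul, hn, zero_mul, mul_zero]

instance unitization_finite [FiniteDimensional F R] : FiniteDimensional F (Unitization F R) :=
  Module.Finite.equiv (Unitization.linearEquiv F F R).symm

theorem exists_inr_eq {F R : Type*} [Zero F] {x : Unitization F R} (hx : x.fst = 0) :
    ∃ a : R, (a : Unitization F R) = x :=
  ⟨x.snd, Unitization.ext hx.symm rfl⟩

/-- A non-nilpotent element of a finite dimensional algebra has a nonzero Drazin inverse. -/
theorem exists_drazin_inverse [FiniteDimensional F R] {a : R}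
    (ha : ¬ IsNilpotent (a : Unitization F R)) :
    ∃ h : R, a * h = h * a ∧ h * a * h = h ∧ a * h ≠ 0 := by
  set α : Unitization F R := Unitization.inr a with hα
  obtain ⟨P, hP, hP0⟩ := (Algebra.IsIntegral.isIntegral (R := F) α)
  obtain ⟨q, hq, hnd⟩ := Polynomial.exists_eq_pow_rootMultiplicity_mul_and_not_dvd P hP.ne_zero 0
  set k := Polynomial.rootMultiplicity 0 P
  rw [Polynomial.C_0, sub_zero] at hq hnd
  rw [Polynomial.X_dvd_iff] at hnd
  set c := q.coeff 0
  set r : Unitization F R := Polynomial.aeval α (Polynomial.C (-c⁻¹) * q.divX) with hr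
  have hcomm : Commute α r := by
    have := Polynomial.aeval_X (R := F) α
    rw [hr]
    nth_rewrite 1 [← this]
    exact (Commute.all _ _).map (Polynomial.aeval α)
  have key : α ^ k * (α * r) = α ^ k := by
    have h1 : Polynomial.aeval α P = 0 := hP0
    have h2 : (Polynomial.X ^ k * (Polynomial.X * (Polynomial.C (-c⁻¹) * q.divX)) : Polynomial F)
        = Polynomial.X ^ k - Polynomial.C c⁻¹ * P := by
      have h3 : P = Polynomial.X ^ k * (q.divX * Polynomial.X + Polynomial.C c) := by
        rw [Polynomial.divX_mul_X_add]; exact hq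
      have h4 : (Polynomial.C c⁻¹ : Polynomial F) * Polynomial.C c = 1 := by
        rw [← Polynomial.C_mul, inv_mul_cancel₀ hnd, Polynomial.C_1]
      rw [h3, Polynomial.C_neg]
      linear_combination (Polynomial.X ^ k : Polynomial F) * h4
    have h5 := congrArg (Polynomial.aeval α) h2
    rw [map_sub, map_mul _ _ P, h1, mul_zero, sub_zero] at h5
    simpa [hr] using h5
  have key2 : ∀ m : ℕ, α ^ k * (α * r) ^ m = α ^ k := by
    intro m
    induction m with
    | zero => simp
    | succ m ih => rw [pow_succ, ← mul_assoc, ih, key]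
  set p := (α * r) ^ (k + 1) with hp
  have hcar : Commute α (α * r) := (Commute.refl α).mul_right hcomm
  have hcrr : Commute r (α * r) := hcomm.symm.mul_right (Commute.refl r)
  have hpk : p = r ^ (k + 1) * α * α ^ k := by
    rw [hp, hcomm.mul_pow, (hcomm.pow_pow (k + 1) (k + 1)).eq, mul_assoc, ← pow_succ']
  have hp1 : ∀ m : ℕ, p * (α * r) ^ m = p := by
    intro m
    rw [hpk, mul_assoc, key2]
  have hpp : p * p = p := hp1 (k + 1)
  have hap : Commute α p := hcar.pow_right _
  have hrp : Commute r p := hcrr.pow_right _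
  have harp : α * (r * p) = p := by
    rw [← mul_assoc, ← (show Commute p (α * r) from ((Commute.refl _).pow_left _)).eq]
    simpa using hp1 1
  obtain ⟨h, hh⟩ := exists_inr_eq (F := F) (R := R) (x := r * p) (by rw [hpk, hα]; simp)
  refine ⟨h, ?_, ?_, ?_⟩
  · apply Unitization.inr_injective (R := F)
    rw [Unitization.inr_mul, Unitization.inr_mul, hh, ← hα]
    exact (hcomm.mul_right hap).eq
  · apply Unitization.inr_injective (R := F)
    rw [Unitization.inr_mul, Unitization.inr_mul, hh, ← hα, mul_assoc, harp, mul_assoc, hpp]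
  · intro h0
    apply ha
    have : (0 : Unitization F R) = p := by
      rw [← harp, ← hh, hα, ← Unitization.inr_mul, h0, Unitization.inr_zero]
    refine ⟨k, ?_⟩
    rw [← key2 (k + 1), ← hp, ← this, mul_zero]

theorem mem_jacobson_of_isNilpotent {u : R}
    (hu : ∀ y : R, IsNilpotent ((u * y : R) : Unitization F R)) :
    (u : Unitization F R) ∈ Ideal.jacobson (⊥ : Ideal (Unitization F R)) := by
  rw [Ideal.mem_jacobson_iff]
  intro y
  have h1 : IsNilpotent ((u : Unitization F R) * y) := by
    obtain ⟨t, ht⟩ := exists_inr_eq (F := F) (R := R) (x := y * u * y) (by simp)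
    obtain ⟨n, hn⟩ := hu t
    refine ⟨2 * n, ?_⟩
    rw [pow_mul, ← hn, Unitization.inr_mul, ht]
    congr 1
    noncomm_ring
  obtain ⟨z, hz⟩ := (isNilpotent_mul_swap h1).isUnit_one_add.exists_left_inv
  refine ⟨z, ?_⟩
  rw [Ideal.mem_bot, ← hz]
  noncomm_ring

/-- In a finite dimensional algebra, an element generating a nil right ideal is in the radical. -/
theorem mem_radical_of_isNilpotent [FiniteDimensional F R] {u : R}
    (hu : ∀ y : R, IsNilpotent ((u * y : R) : Unitization F R)) : u ∈ radical R := by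
  have : IsArtinianRing (Unitization F R) := IsArtinianRing.of_finite F _
  set J := Ideal.jacobson (⊥ : Ideal (Unitization F R)) with hJ
  obtain ⟨n, hn⟩ : IsNilpotent J := IsArtinianRing.isNilpotent_jacobson_bot
  let T : TwoSidedIdeal R := TwoSidedIdeal.mk' {x : R | (x : Unitization F R) ∈ J}
    (by simp) (fun hx hy => by simpa using J.add_mem hx hy) (fun hx => by simpa using hx)
    (fun {x y} hy => by simpa using J.mul_mem_left _ hy)
    (fun {x y} hx => by simpa using J.mul_mem_right _ hx)
  have hT : ∀ x : R, x ∈ T ↔ (x : Unitization F R) ∈ J := fun x => by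
    exact TwoSidedIdeal.mem_mk' ..
  have hprod : ∀ m : ℕ, ∀ x ∈ products (T : Set R) m, (x : Unitization F R) ∈ J ^ (m + 1) := by
    intro m
    induction m with
    | zero => intro x hx; simpa [Submodule.pow_one] using (hT x).1 hx
    | succ m ih =>
      rintro x ⟨a, ha, b, hb, rfl⟩
      rw [Unitization.inr_mul, Ideal.IsTwoSided.pow_succ]
      exact Ideal.mul_mem_mul ((hT a).1 ha) (ih b hb)
  have hnil : IsNilpotentIdeal T := by
    refine ⟨n, fun x hx => ?_⟩
    have h1 := hprod n x hx
    have h2 : (x : Unitization F R) ∈ (0 : Ideal (Unitization F R)) :=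
      hn ▸ Ideal.pow_le_pow_right n.le_succ h1
    exact Unitization.inr_injective (R := F) (by simpa using h2)
  exact (le_sSup (a := T) (s := {J : TwoSidedIdeal R | IsNilpotentIdeal J}) hnil)
    ((hT u).2 (mem_jacobson_of_isNilpotent hu))

end Nilpotent
section Pairs

variable {F R : Type*} [Field F] [NonUnitalRing R] [Module F R]

theorem mul_mul_eq_of_mul_eq {a b c : R} (h : a * b = c) (t : R) : a * (b * t) = c * t := by
  rw [← mul_assoc, h]

variable (F) in
/-- The two-sided ideal `RfR`. -/
def idealSpan (f : R) : Submodule F R :=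
  Submodule.span F {z | ∃ c d : R, z = c * f * d}

theorem mul_mul_mem_idealSpan (c f d : R) : c * f * d ∈ idealSpan F f :=
  Submodule.subset_span ⟨c, d, rfl⟩

theorem idealSpan_le {f f' : R} (h : f' * f = f) :
    idealSpan F f ≤ idealSpan F f' := by
  rw [idealSpan, Submodule.span_le]
  rintro _ ⟨c, d, rfl⟩
  exact Submodule.subset_span ⟨c, f * d, by rw [mul_assoc c f', mul_mul_eq_of_mul_eq h, mul_assoc]⟩

/-- An orthogonal pair of idempotents `(e, f)` with `eRf ⊆ B`, each generating the same two-sided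
ideal. -/
structure IsStrictPairIn (B : Submodule F R) (e f : R) : Prop where
  orth : IsOrthogonalIdempotentPair e f
  mem : ∀ r : R, e * r * f ∈ B
  left : e ∈ idealSpan F f
  right : f ∈ idealSpan F e

variable {B : Submodule F R} {e f : R}

theorem mem_lieDerived_one {x : R} (h₁ : x * e = x) (h₂ : e * x = 0) : x ∈ lieDerived F R 1 := by
  have : x = ⁅x, e⁆ := by rw [Ring.lie_def, h₁, h₂, sub_zero]
  exact Submodule.subset_span ⟨x, trivial, e, trivial, this⟩

theorem mem_lieDerived_one' {x : R} (h₁ : e * x = x) (h₂ : x * e = 0) : x ∈ lieDerived F R 1 := by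
  have : x = ⁅e, x⁆ := by rw [Ring.lie_def, h₁, h₂, sub_zero]
  exact Submodule.subset_span ⟨e, trivial, x, trivial, this⟩

namespace IsJordanLie

theorem jordan_mem {L : Submodule F R} (hB : IsJordanLie L B) {b b' x : R} (hb : b ∈ B)
    (hb' : b' ∈ B) (hx : x ∈ L) : b * x * b' + b' * x * b ∈ B := by
  have h1 := hB.1.2 b hb b' hb' x hx
  have h2 : b * x * b' + b' * x * b = -⁅b, ⁅b', x⁆⁆ := by
    have h3 := hB.2 b hb b' hb'
    have h4 := hB.2 b' hb' b hb
    simp only [Ring.lie_def, mul_sub, sub_mul, mul_assoc, h4, mul_mul_eq_of_mul_eq h3, zero_mul,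
      mul_zero]
    abel
  rw [h2]
  exact B.neg_mem h1

theorem quadratic_mem {L : Submodule F R} (hB : IsJordanLie L B) (h2 : (2 : F) ≠ 0) {b x : R}
    (hb : b ∈ B) (hx : x ∈ L) : b * x * b ∈ B := by
  have h := hB.jordan_mem hb hb hx
  rw [← two_smul F] at h
  exact (B.smul_mem_iff h2).1 h

theorem quartic_mem (hB : IsJordanLie (lieDerived F R 1) B) (h2 : (2 : F) ≠ 0) {b : R}
    (hb : b ∈ B) (y z : R) : b * y * b * z * b ∈ B := by
  have h := hB.quadratic_mem h2 hb (x := ⁅y * b, z⁆)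
    (Submodule.subset_span ⟨y * b, trivial, z, trivial, rfl⟩)
  have h3 := hB.2 b hb b hb
  simpa only [Ring.lie_def, mul_sub, sub_mul, mul_assoc, h3, mul_zero, sub_zero] using h

end IsJordanLie

/-- `x` is annihilated by `e` and `f` on both sides. -/
structure IsOrthTo (e f x : R) : Prop where
  left_mul : e * x = 0
  mul_left : x * e = 0
  right_mul : f * x = 0
  mul_right : x * f = 0

theorem IsOrthTo.mul {x y : R} (hx : IsOrthTo e f x) (hy : IsOrthTo e f y) :
    IsOrthTo e f (x * y) where
  left_mul := by rw [← mul_assoc, hx.left_mul, zero_mul]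
  mul_left := by rw [mul_assoc, hy.mul_left, mul_zero]
  right_mul := by rw [← mul_assoc, hx.right_mul, zero_mul]
  mul_right := by rw [mul_assoc, hy.mul_right, mul_zero]

theorem IsOrthTo.sub {x y : R} (hx : IsOrthTo e f x) (hy : IsOrthTo e f y) :
    IsOrthTo e f (x - y) where
  left_mul := by rw [mul_sub, hx.left_mul, hy.left_mul, sub_zero]
  mul_left := by rw [sub_mul, hx.mul_left, hy.mul_left, sub_zero]
  right_mul := by rw [mul_sub, hx.right_mul, hy.right_mul, sub_zero]
  mul_right := by rw [sub_mul, hx.mul_right, hy.mul_right, sub_zero]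

theorem IsOrthTo.zero : IsOrthTo e f 0 := by constructor <;> simp

theorem IsOrthTo.of_drazin {a h : R} (ha : IsOrthTo e f a) (hc : a * h = h * a)
    (hh : h * a * h = h) : IsOrthTo e f h := by
  have h1 : a * (h * h) = h := by rw [← mul_assoc, hc, hh]
  have h2 : h * h * a = h := by rw [mul_assoc, ← hc, ← mul_assoc, hh]
  constructor
  · rw [← h1, ← mul_assoc, ha.left_mul, zero_mul]
  · rw [← h2, mul_assoc, ha.mul_left, mul_zero]
  · rw [← h1, ← mul_assoc, ha.right_mul, zero_mul]
  · rw [← h2, mul_assoc, ha.mul_right, mul_zero]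

theorem IsStrictPairIn.extend (hP : IsStrictPairIn B e f) {p q : R} (hp : IsOrthTo e f p)
    (hq : IsOrthTo e f q) (hpp : p * p = p) (hqq : q * q = q) (hpq : p * q = 0) (hqp : q * p = 0)
    (h₁ : ∀ r, e * r * q ∈ B) (h₂ : ∀ r, p * r * f ∈ B) (h₃ : ∀ r, p * r * q ∈ B)
    (hl : p ∈ idealSpan F (f + q)) (hr : q ∈ idealSpan F (e + p)) :
    IsStrictPairIn B (e + p) (f + q) := by
  obtain ⟨⟨hee, hff, hef, hfe⟩, hm, hle, hri⟩ := hP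
  refine ⟨⟨?_, ?_, ?_, ?_⟩, fun r => ?_, ?_, ?_⟩
  · simp only [IsIdempotentElem] at hee ⊢
    simp [mul_add, add_mul, hee, hpp, hp.left_mul, hp.mul_left]
  · simp only [IsIdempotentElem] at hff ⊢
    simp [mul_add, add_mul, hff, hqq, hq.right_mul, hq.mul_right]
  · simp [mul_add, add_mul, hef, hp.mul_right, hq.left_mul, hpq]
  · simp [mul_add, add_mul, hfe, hp.right_mul, hq.mul_left, hqp]
  · simp only [mul_add, add_mul]
    exact B.add_mem (B.add_mem (hm r) (h₂ r)) (B.add_mem (h₁ r) (h₃ r))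
  · refine Submodule.add_mem _ (idealSpan_le ?_ hle) hl
    rw [add_mul, hff.eq, hq.mul_right, add_zero]
  · refine Submodule.add_mem _ (idealSpan_le ?_ hri) hr
    rw [add_mul, hee.eq, hp.mul_left, add_zero]

variable [IsScalarTower F R R] [SMulCommClass F R R]

theorem sandwich_mem_of_mem_idealSpan {P : Submodule F R} {f z a b : R} (hz : z ∈ idealSpan F f)
    (h : ∀ c d : R, a * (c * f * d) * b ∈ P) : a * z * b ∈ P := by
  have : idealSpan F f ≤
      P.comap ((LinearMap.mulRight F b).comp (LinearMap.mulLeft F a)) := by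
    rw [idealSpan, Submodule.span_le]
    rintro _ ⟨c, d, rfl⟩
    exact h c d
  exact this hz

namespace IsStrictPairIn

theorem right_mul (hP : IsStrictPairIn B e f) {L : Submodule F R} (hB : IsJordanLie L B) {b : R}
    (hb : b ∈ B) : f * b = 0 := by
  have hff : f * f = f := hP.orth.2.1
  have := sandwich_mem_of_mem_idealSpan (P := ⊥) (a := f) (b := f * b) hP.right fun c d => by
    have h1 := hB.2 _ (hP.mem d) b hb
    have h2 : f * (c * e * d) * (f * b) = f * c * (e * d * f * b) := by simp only [mul_assoc]
    rw [h2, h1, mul_zero, Submodule.mem_bot]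
  simpa [mul_assoc, hff, mul_mul_eq_of_mul_eq hff] using this

theorem mul_left (hP : IsStrictPairIn B e f) {L : Submodule F R} (hB : IsJordanLie L B) {b : R}
    (hb : b ∈ B) : b * e = 0 := by
  have hee : e * e = e := hP.orth.1
  have := sandwich_mem_of_mem_idealSpan (P := ⊥) (a := b * e) (b := e) hP.left fun c d => by
    have h1 := hB.2 b hb _ (hP.mem c)
    have h2 : b * e * (c * f * d) * e = b * (e * c * f) * (d * e) := by simp only [mul_assoc]
    rw [h2, h1, zero_mul, Submodule.mem_bot]
  simpa [mul_assoc, hee, mul_mul_eq_of_mul_eq hee] using this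

end IsStrictPairIn

/-- In the presence of elements `e`, `f` annihilating a non-radical element `u` on the left, some
`u * y * (1 - e - f)` has a nonzero Drazin inverse. -/
theorem exists_drazin_inverse_right [FiniteDimensional F R] {e f u : R} (heu : e * u = 0)
    (hfu : f * u = 0) (hu : u ∉ radical R) :
    ∃ y h : R, (u * y - u * y * e - u * y * f) * h = h * (u * y - u * y * e - u * y * f) ∧
      h * (u * y - u * y * e - u * y * f) * h = h ∧
      (u * y - u * y * e - u * y * f) * h ≠ 0 := by
  by_contra! hcon
  refine hu (mem_radical_of_isNilpotent (F := F) fun y => ?_)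
  by_contra hy
  have hn : ¬ IsNilpotent ((u * y - u * y * e - u * y * f : R) : Unitization F R) := by
    intro hn
    have h1 : ((u * y - u * y * e - u * y * f : R) : Unitization F R) =
        ((u * y : R) : Unitization F R) * (1 - e - f) := by
      simp [mul_sub]
    rw [h1] at hn
    have h2 := isNilpotent_mul_swap hn
    rw [sub_mul, sub_mul, ← Unitization.inr_mul, ← Unitization.inr_mul, ← mul_assoc, ← mul_assoc,
      heu, hfu] at h2
    simp only [one_mul, zero_mul, Unitization.inr_zero, sub_zero] at h2
    exact hy h2
  obtain ⟨h, h1, h2, h3⟩ := exists_drazin_inverse hn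
  exact h3 (hcon y h h1 h2)

theorem exists_drazin_inverse_left [FiniteDimensional F R] {e f v : R} (hve : v * e = 0)
    (hvf : v * f = 0) (hv : v ∉ radical R) :
    ∃ y h : R, (y * v - e * (y * v) - f * (y * v)) * h = h * (y * v - e * (y * v) - f * (y * v)) ∧
      h * (y * v - e * (y * v) - f * (y * v)) * h = h ∧
      (y * v - e * (y * v) - f * (y * v)) * h ≠ 0 := by
  by_contra! hcon
  refine hv (mem_radical_of_isNilpotent (F := F) fun y => ?_)
  by_contra hy
  have hn : ¬ IsNilpotent ((y * v - e * (y * v) - f * (y * v) : R) : Unitization F R) := by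
    intro hn
    have h1 : ((y * v - e * (y * v) - f * (y * v) : R) : Unitization F R) =
        (1 - e - f) * ((y * v : R) : Unitization F R) := by
      simp [sub_mul]
    rw [h1] at hn
    have h2 := isNilpotent_mul_swap hn
    rw [mul_sub, mul_sub, ← Unitization.inr_mul, ← Unitization.inr_mul, mul_assoc, mul_assoc,
      hve, hvf] at h2
    simp only [mul_one, mul_zero, Unitization.inr_zero, sub_zero, Unitization.inr_mul] at h2
    exact hy (by simpa using isNilpotent_mul_swap h2)
  obtain ⟨h, h1, h2, h3⟩ := exists_drazin_inverse hn
  exact h3 (hcon y h h1 h2)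

/-- The pair `(e, f)` can be enlarged to `(e + p, f + q)`. -/
def IsExtendable (B : Submodule F R) (e f : R) : Prop :=
  ∃ p q : R, IsStrictPairIn B (e + p) (f + q) ∧ IsOrthTo e f p ∧ IsOrthTo e f q ∧
    p * p = p ∧ q * q = q ∧ p * q = 0 ∧ q * p = 0 ∧ (p ≠ 0 ∨ q ≠ 0)

theorem IsStrictPairIn.isExtendable_of_right (hP : IsStrictPairIn B e f)
    (hB : IsJordanLie (lieDerived F R 1) B) (h2 : (2 : F) ≠ 0) {b z : R} (hb : b ∈ B)
    (hebf : e * (b * f) = 0) (hfz : f * z = z) (hze : z * e = 0) (hzf : z * f = 0)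
    (hz : z * (b * z) = z) (hz0 : z ≠ 0) : IsExtendable B e f := by
  have hee : e * e = e := hP.orth.1
  have hef : e * f = 0 := hP.orth.2.2.1
  have hfb := hP.right_mul hB hb
  have hebz : e * (b * z) = 0 := by
    rw [← hfz, ← mul_assoc b, ← mul_assoc e, hebf, zero_mul]
  have hp : IsOrthTo e f (b * z) :=
    ⟨hebz, by rw [mul_assoc, hze, mul_zero], by rw [← mul_assoc, hfb, zero_mul],
      by rw [mul_assoc, hzf, mul_zero]⟩
  have hpp : b * z * (b * z) = b * z := by rw [mul_assoc, hz]
  have hmem : b * z * b ∈ B := hB.quadratic_mem h2 hb (mem_lieDerived_one' hfz hzf)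
  have h1 : ∀ r, b * z * b * f * r * f * f ∈ B := fun r => by
    refine sandwich_mem_of_mem_idealSpan hP.right fun c d => ?_
    have h := hB.jordan_mem hmem (hP.mem d) (x := f * (r * c) * e)
      (mem_lieDerived_one (e := e) (by simp only [mul_assoc, hee])
        (by simp only [mul_assoc, mul_mul_eq_of_mul_eq hef, zero_mul]))
    simpa only [mul_assoc, mul_mul_eq_of_mul_eq hebz, hebz, mul_mul_eq_of_mul_eq hee,
      hebz, ← mul_assoc e b, show e * b * z = 0 by rw [mul_assoc, hebz],
      mul_mul_eq_of_mul_eq (show e * b * z = 0 by rw [mul_assoc, hebz]), zero_mul, mul_zero,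
      add_zero] using h
  refine ⟨b * z, 0, hP.extend hp .zero hpp (by simp) (by simp) (by simp) (by simp) (fun r => ?_)
    (by simp) ?_ (by simp), hp, .zero, hpp, by simp, by simp, by simp, Or.inl fun h0 => hz0 ?_⟩
  · have h3 := h1 (z * r)
    have hff : f * f = f := hP.orth.2.1
    have h4 : b * z * b * f * (z * r) * f * f = b * z * (b * z) * r * f := by
      simp only [mul_assoc, hff, mul_mul_eq_of_mul_eq hfz]
    rwa [h4, hpp] at h3
  · rw [add_zero, ← hfz, ← mul_assoc]
    exact mul_mul_mem_idealSpan b f z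
  · rw [← hz, h0, mul_zero]

theorem IsStrictPairIn.isExtendable_of_left (hP : IsStrictPairIn B e f)
    (hB : IsJordanLie (lieDerived F R 1) B) (h2 : (2 : F) ≠ 0) {b z : R} (hb : b ∈ B)
    (hebf : e * (b * f) = 0) (hze : z * e = z) (hez : e * z = 0) (hfz : f * z = 0)
    (hz : z * (b * z) = z) (hz0 : z ≠ 0) : IsExtendable B e f := by
  have hee : e * e = e := hP.orth.1
  have hff : f * f = f := hP.orth.2.1
  have hef : e * f = 0 := hP.orth.2.2.1
  have hbe := hP.mul_left hB hb
  have hzbf : z * (b * f) = 0 := by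
    rw [← hze, mul_assoc, hebf, mul_zero]
  have hq : IsOrthTo e f (z * b) :=
    ⟨by rw [← mul_assoc, hez, zero_mul], by rw [mul_assoc, hbe, mul_zero],
      by rw [← mul_assoc, hfz, zero_mul], by rw [mul_assoc, hzbf]⟩
  have hqq : z * b * (z * b) = z * b := by rw [← mul_assoc, mul_assoc z b z, hz]
  have hmem : b * z * b ∈ B := hB.quadratic_mem h2 hb (mem_lieDerived_one hze hez)
  have h1 : ∀ r, e * e * (r * e * b * z * b) ∈ B := fun r => by
    refine sandwich_mem_of_mem_idealSpan hP.left fun c d => ?_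
    have h := hB.jordan_mem (hP.mem c) hmem (x := f * (d * r) * e)
      (mem_lieDerived_one (e := e) (by simp only [mul_assoc, hee])
        (by simp only [mul_assoc, mul_mul_eq_of_mul_eq hef, zero_mul]))
    have h3 : b * z * b * (f * (d * r) * e) * (e * c * f) = 0 := by
      have : b * z * b * (f * (d * r) * e) * (e * c * f) =
        b * (z * (b * f)) * (d * r * e * (e * c * f)) := by simp only [mul_assoc]
      rw [this, hzbf, mul_zero, zero_mul]
    rw [h3, add_zero] at h
    simpa only [mul_assoc, mul_mul_eq_of_mul_eq hff] using h
  refine ⟨0, z * b, hP.extend .zero hq (by simp) hqq (by simp) (by simp) (fun r => ?_) (by simp)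
    (by simp) (by simp) ?_, .zero, hq, by simp, hqq, by simp, by simp, Or.inr fun h0 => hz0 ?_⟩
  · have h3 := h1 (r * z)
    have h4 : e * e * (r * z * e * b * z * b) = e * r * (z * b * (z * b)) := by
      simp only [mul_assoc, mul_mul_eq_of_mul_eq hee, mul_mul_eq_of_mul_eq hze]
    rwa [h4, hqq] at h3
  · rw [add_zero, ← hze]
    exact mul_mul_mem_idealSpan z e b
  · rw [← hz, ← mul_assoc, h0, zero_mul]

theorem IsStrictPairIn.isExtendable_of_both (hP : IsStrictPairIn B e f)
    (hB : IsJordanLie (lieDerived F R 1) B) (h2 : (2 : F) ≠ 0) {b w z : R} (hb : b ∈ B)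
    (hw : b = w + b * f + e * b) (hwo : IsOrthTo e f w) (hzo : IsOrthTo e f z)
    (hz : z * (w * z) = z) (hz0 : z ≠ 0) : IsExtendable B e f := by
  have hee : e * e = e := hP.orth.1
  have hff : f * f = f := hP.orth.2.1
  have hef : e * f = 0 := hP.orth.2.2.1
  have hfe : f * e = 0 := hP.orth.2.2.2
  have hfb := hP.right_mul hB hb
  have hbe := hP.mul_left hB hb
  have hzb : z * b = z * w + z * b * f := by
    conv_lhs => rw [hw]
    rw [mul_add, mul_add, ← mul_assoc z e, hzo.mul_left, zero_mul, add_zero, mul_assoc]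
  have hbz : b * z = w * z + e * b * z := by
    conv_lhs => rw [hw]
    rw [add_mul, add_mul, mul_assoc b f, hzo.right_mul, mul_zero, add_zero]
  have hzbz : z * (b * z) = z := by
    rw [hbz, mul_add, hz, mul_assoc, ← mul_assoc z, hzo.mul_left, zero_mul, add_zero]
  have hmem : b * z * b ∈ B := by
    have := hB.quartic_mem h2 hb z z
    rwa [mul_assoc b z b, mul_assoc b (z * b) z, mul_assoc z b z, hzbz] at this
  have hww : w * w = 0 := by
    have hbb := hB.2 b hb b hb
    have hw' : w = b - b * f - e * b := by
      rw [eq_sub_iff_add_eq, eq_sub_iff_add_eq, add_right_comm]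
      exact hw.symm
    have hbw : b * w = 0 := by
      rw [hw', mul_sub, mul_sub, hbb, ← mul_assoc, hbb, zero_mul, ← mul_assoc, hbe]; simp
    have h : w * w = (b - b * f - e * b) * w := congrArg (· * w) hw'
    rw [h, sub_mul, sub_mul, mul_assoc, mul_assoc, hbw, hwo.right_mul]
    simp
  have hpp : w * z * (w * z) = w * z := by rw [mul_assoc, hz]
  have hqq : z * w * (z * w) = z * w := by rw [← mul_assoc, mul_assoc z w z, hz]
  have h1 : ∀ r, w * z * w * r * f * f ∈ B := fun r => by
    refine sandwich_mem_of_mem_idealSpan hP.right fun c d => ?_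
    set s := r * c * e - e * (r * c * e) - f * (r * c * e) with hs
    have hes : e * s = 0 := by
      rw [hs, mul_sub, mul_sub, ← mul_assoc e e, hee, ← mul_assoc e f, hef]; simp
    have hfs : f * s = 0 := by
      rw [hs, mul_sub, mul_sub, ← mul_assoc f f, hff, ← mul_assoc f e, hfe]; simp
    have hse : s * e = s := by simp only [hs, sub_mul, mul_assoc, hee]
    have hws : w * s = w * r * c * e := by
      rw [hs, mul_sub, mul_sub, ← mul_assoc w e, hwo.mul_left, ← mul_assoc w f, hwo.mul_right]
      simp [mul_assoc]
    have hzbs : z * (b * s) = z * (w * s) := by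
      rw [← mul_assoc, hzb, add_mul, mul_assoc _ f, hfs, mul_zero, add_zero, mul_assoc]
    have h := hB.jordan_mem hmem (hP.mem d) (mem_lieDerived_one hse hes)
    have h4 : b * z * b * s * (e * d * f) + e * d * f * s * (b * z * b) =
        w * z * w * r * (c * e * d) * f + e * (b * z * w * s * e * d) * f := by
      have hk : b * z * b * s = (w * z + e * b * z) * (w * s) := by
        rw [mul_assoc (b * z), mul_assoc b z, hzbs, ← mul_assoc b z, hbz]
      rw [mul_assoc (e * d), hfs, mul_zero, zero_mul, add_zero, hk, add_mul, add_mul]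
      simp only [mul_assoc, mul_mul_eq_of_mul_eq hws, mul_mul_eq_of_mul_eq hee]
    rw [h4] at h
    exact (B.add_mem_iff_left (hP.mem _)).1 h
  have h1' : ∀ r, w * z * r * f ∈ B := fun r => by
    have h4 : w * z * w * (z * r) * f * f = w * z * (w * z) * r * f := by
      simp only [mul_assoc, hff]
    rw [← hpp, ← h4]
    exact h1 _
  have h3 : ∀ r, e * e * (r * w * z * w) ∈ B := fun r => by
    refine sandwich_mem_of_mem_idealSpan hP.left fun c d => ?_
    set s := f * d * r - f * d * r * e - f * d * r * f with hs
    have hse : s * e = 0 := by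
      rw [hs, sub_mul, sub_mul, mul_assoc _ e, hee, mul_assoc _ f, hfe]; simp
    have hsf : s * f = 0 := by
      rw [hs, sub_mul, sub_mul, mul_assoc _ f, hff, mul_assoc _ e, hef]; simp
    have hfs : f * s = s := by
      simp only [hs, mul_sub, mul_assoc, mul_mul_eq_of_mul_eq hff]
    have hsw : s * w = f * d * r * w := by
      rw [hs, sub_mul, sub_mul, mul_assoc _ e, hwo.left_mul, mul_assoc _ f, hwo.right_mul]
      simp
    have hsbz : s * (b * z) = s * w * z := by
      rw [hbz, mul_add, mul_assoc e, ← mul_assoc s e, hse, zero_mul, add_zero, mul_assoc]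
    have h := hB.jordan_mem (hP.mem c) hmem (mem_lieDerived_one' hfs hsf)
    have h4 : e * c * f * s * (b * z * b) + b * z * b * s * (e * c * f) =
        e * (c * f * d) * (r * w * z * w) + e * (c * f * s * w * z * b) * f := by
      rw [mul_assoc e c f, ← mul_assoc (b * z * b * s), mul_assoc (b * z * b), hse, mul_zero,
        zero_mul, add_zero, mul_assoc (e * (c * f)), ← mul_assoc s, hsbz, mul_assoc (s * w), hzb,
        mul_add, mul_add, hsw]
      simp only [mul_assoc, mul_mul_eq_of_mul_eq hff, mul_mul_eq_of_mul_eq hsw]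
    rw [h4] at h
    exact (B.add_mem_iff_left (hP.mem _)).1 h
  have h3' : ∀ r, e * r * (z * w) ∈ B := fun r => by
    have h4 : e * e * (r * z * w * z * w) = e * r * (z * w * (z * w)) := by
      simp only [mul_assoc, mul_mul_eq_of_mul_eq hee]
    rw [← hqq, ← h4]
    exact h3 _
  have hmem' : w * z * w ∈ B := by
    have h5 : b * z * b = w * z * w + e * b * (z * w) + w * z * b * f + e * (b * z * b) * f := by
      have hk : b * z * b = w * (z * b) + e * b * (z * b) := by
        rw [hbz, add_mul, mul_assoc w z b, mul_assoc (e * b) z b]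
      refine hk.trans ((congrArg (fun t => w * t + e * b * t) hzb).trans ?_)
      simp only [mul_add, mul_assoc]
      abel
    rw [h5] at hmem
    exact (B.add_mem_iff_left (h3' b)).1 ((B.add_mem_iff_left (h1' b)).1
      ((B.add_mem_iff_left (hP.mem _)).1 hmem))
  have hpq : ∀ r, w * z * r * (z * w) ∈ B := fun r => by
    have h5 := hB.quartic_mem h2 hmem' z (z * r * z)
    have h6 : w * z * w * z * (w * z * w) * (z * r * z) * (w * z * w) =
        w * z * (w * z) * (w * z) * (w * z) * r * (z * w * (z * w)) := by simp only [mul_assoc]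
    rwa [h6, hpp, hpp, hpp, hqq] at h5
  have hqp : z * w * (w * z) = 0 := by
    rw [mul_assoc, ← mul_assoc w, hww, zero_mul, mul_zero]
  have hp := hwo.mul hzo
  have hq := hzo.mul hwo
  have hpz : z * (w * z) * w = z * w := by rw [hz]
  obtain ⟨p, hpdef⟩ : ∃ p, w * z = p := ⟨_, rfl⟩
  obtain ⟨q, hqdef⟩ : ∃ q, z * w = q := ⟨_, rfl⟩
  rw [hpdef, hqdef] at hpz
  rw [hpdef] at hpp hqp hp
  rw [hqdef] at hqq hqp hq
  simp only [hpdef, hqdef] at h1' h3' hpq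
  have hqq1 : q * (q - p * q) = q := by rw [mul_sub, hqq, ← mul_assoc, hqp, zero_mul, sub_zero]
  have hpq1 : p * (q - p * q) = 0 := by rw [mul_sub, ← mul_assoc, hpp, sub_self]
  refine ⟨p, q - p * q, hP.extend hp (hq.sub (hp.mul hq)) hpp ?_ hpq1 ?_ (fun r => ?_) h1'
    (fun r => ?_) ?_ ?_, hp, hq.sub (hp.mul hq), hpp, ?_, hpq1, ?_, Or.inl fun h0 => hz0 ?_⟩
  · rw [sub_mul, mul_assoc p, hqq1]
  · rw [sub_mul, mul_assoc, hqp, mul_zero, sub_zero]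
  · have := h3' (r - r * p)
    rwa [mul_sub, sub_mul, ← mul_assoc _ r p, mul_assoc _ p q, ← mul_sub] at this
  · have := hpq (r - r * p)
    rwa [mul_sub, sub_mul, ← mul_assoc _ r p, mul_assoc _ p q, ← mul_sub] at this
  · have h5 : p = w * q * (f + (q - p * q)) * z := by
      rw [mul_assoc w q, mul_add, hq.mul_right, hqq1, zero_add, ← hqdef, ← hpp, ← hpdef]
      simp only [mul_assoc]
    have h6 := mul_mul_mem_idealSpan (F := F) (w * q) (f + (q - p * q)) z
    rwa [← h5] at h6
  · refine Submodule.sub_mem _ ?_ ?_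
    · have h5 : q = z * (e + p) * (p * w) := by
        rw [mul_add, hzo.mul_left, zero_add, ← mul_assoc, mul_assoc z p p, hpp, hpz]
      have h6 := mul_mul_mem_idealSpan (F := F) z (e + p) (p * w)
      rwa [← h5] at h6
    · have h5 : p * q = p * (e + p) * q := by
        rw [mul_add, hp.mul_left, zero_add, hpp]
      rw [h5]
      exact mul_mul_mem_idealSpan _ _ _
  · rw [sub_mul, mul_assoc p, hqq1]
  · rw [sub_mul, mul_assoc, hqp, mul_zero, sub_zero]
  · rw [← hz, hpdef, h0, mul_zero]

end Pairs
section Main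

variable {F R : Type*} [Field F] [NonUnitalRing R] [Module F R] [IsScalarTower F R R]
  [SMulCommClass F R R] {B : Submodule F R} {e f : R}

/-- If `B ⊈ eBf + rad R`, the pair `(e, f)` can be enlarged. -/
theorem IsStrictPairIn.isExtendable [FiniteDimensional F R] (hP : IsStrictPairIn B e f)
    (hB : IsJordanLie (lieDerived F R 1) B) (h2 : (2 : F) ≠ 0) {b : R} (hb : b ∈ B)
    (hbr : b - e * b * f ∉ radical R) : IsExtendable B e f := by
  have hee : e * e = e := hP.orth.1
  have hff : f * f = f := hP.orth.2.1
  have hef : e * f = 0 := hP.orth.2.2.1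
  have hfe : f * e = 0 := hP.orth.2.2.2
  set c := b - e * b * f with hc
  have hcB : c ∈ B := B.sub_mem hb (hP.mem b)
  have hfc := hP.right_mul hB hcB
  have hce := hP.mul_left hB hcB
  have hecf : e * (c * f) = 0 := by
    simp only [hc, mul_sub, sub_mul, mul_assoc, mul_mul_eq_of_mul_eq hee, hff, sub_self]
  have hec_f : e * c * f = 0 := by rw [mul_assoc, hecf]
  by_cases hu : c * f ∈ radical R
  · by_cases hv : e * c ∈ radical R
    · set w := c - c * f - e * c with hw
      have hwr : w ∉ radical R := fun hwr => hbr <| by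
        have h := (radical R).add_mem ((radical R).add_mem hwr hv) hu
        rwa [hw, sub_add_cancel, sub_add_cancel] at h
      have hwo : IsOrthTo e f w := by
        constructor <;>
          simp [hw, mul_sub, sub_mul, mul_assoc, hce, hfc, hecf, hff, mul_mul_eq_of_mul_eq hee,
            mul_mul_eq_of_mul_eq hfe, mul_mul_eq_of_mul_eq hfc, hfe]
      obtain ⟨y, h, h₁, h₂, h₃⟩ :=
        exists_drazin_inverse_right (F := F) hwo.left_mul hwo.right_mul hwr
      set t := y - e * y - f * y with ht
      have hta : w * (t - t * e - t * f) = w * y - w * y * e - w * y * f := by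
        simp only [ht, mul_sub, sub_mul, ← mul_assoc, hwo.mul_left, hwo.mul_right]
        simp
      rw [← hta] at h₁ h₂ h₃
      have hxo : IsOrthTo e f (t - t * e - t * f) := by
        constructor <;>
          simp [ht, mul_sub, sub_mul, mul_assoc, hee, hff, hef, hfe, mul_mul_eq_of_mul_eq hee,
            mul_mul_eq_of_mul_eq hff, mul_mul_eq_of_mul_eq hef, mul_mul_eq_of_mul_eq hfe]
      set x := t - t * e - t * f
      have hho := (hwo.mul hxo).of_drazin h₁ h₂
      refine hP.isExtendable_of_both hB h2 hcB (w := w) (z := x * h) (by rw [hw]; abel) hwo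
        (hxo.mul hho) ?_ fun h0 => h₃ (by rw [mul_assoc, h0, mul_zero])
      calc x * h * (w * (x * h)) = x * (h * (w * x) * h) := by simp only [mul_assoc]
        _ = x * h := by rw [h₂]
    · obtain ⟨y, h, h₁, h₂, h₃⟩ := exists_drazin_inverse_left (F := F) (e := e) (f := f)
        (by rw [mul_assoc, hce, mul_zero]) hec_f hv
      have hxa : (y * e - e * (y * e) - f * (y * e)) * c =
          y * (e * c) - e * (y * (e * c)) - f * (y * (e * c)) := by
        simp only [sub_mul, mul_assoc]
      rw [← hxa] at h₁ h₂ h₃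
      have hxe : (y * e - e * (y * e) - f * (y * e)) * e = y * e - e * (y * e) - f * (y * e) := by
        simp only [sub_mul, mul_assoc, hee]
      have hex : e * (y * e - e * (y * e) - f * (y * e)) = 0 := by
        simp [mul_sub, mul_mul_eq_of_mul_eq hee, mul_mul_eq_of_mul_eq hef]
      have hfx : f * (y * e - e * (y * e) - f * (y * e)) = 0 := by
        simp [mul_sub, mul_mul_eq_of_mul_eq hff, mul_mul_eq_of_mul_eq hfe]
      set x := y * e - e * (y * e) - f * (y * e)
      have hxcf : x * c * f = 0 := by rw [← hxe, mul_assoc x, mul_assoc x, hec_f, mul_zero]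
      have hao : IsOrthTo e f (x * c) :=
        ⟨by rw [← mul_assoc, hex, zero_mul], by rw [mul_assoc, hce, mul_zero],
          by rw [← mul_assoc, hfx, zero_mul], hxcf⟩
      have hho := hao.of_drazin h₁ h₂
      refine hP.isExtendable_of_left hB h2 hcB hecf (z := h * x) (by rw [mul_assoc, hxe])
        (by rw [← mul_assoc, hho.left_mul, zero_mul])
        (by rw [← mul_assoc, hho.right_mul, zero_mul]) ?_
        fun h0 => h₃ (by rw [h₁, ← mul_assoc, h0, zero_mul])
      calc h * x * (c * (h * x)) = h * (x * c) * h * x := by simp only [mul_assoc]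
        _ = h * x := by rw [h₂]
  · obtain ⟨y, h, h₁, h₂, h₃⟩ := exists_drazin_inverse_right (F := F) (e := e) (f := f) hecf
      (by rw [← mul_assoc, hfc, zero_mul]) hu
    have hxa : c * (f * y - f * y * e - f * y * f) =
        c * f * y - c * f * y * e - c * f * y * f := by
      simp only [mul_sub, mul_assoc]
    rw [← hxa] at h₁ h₂ h₃
    have hfx : f * (f * y - f * y * e - f * y * f) = f * y - f * y * e - f * y * f := by
      simp only [mul_sub, mul_assoc, mul_mul_eq_of_mul_eq hff]
    have hxe : (f * y - f * y * e - f * y * f) * e = 0 := by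
      simp [sub_mul, mul_assoc, hee, hfe]
    have hxf : (f * y - f * y * e - f * y * f) * f = 0 := by
      simp [sub_mul, mul_assoc, hff, hef]
    set x := f * y - f * y * e - f * y * f
    have hecx : e * (c * x) = 0 := by
      rw [← hfx, ← mul_assoc c, ← mul_assoc e, hecf, zero_mul]
    have hao : IsOrthTo e f (c * x) :=
      ⟨hecx, by rw [mul_assoc, hxe, mul_zero], by rw [← mul_assoc, hfc, zero_mul],
        by rw [mul_assoc, hxf, mul_zero]⟩
    have hho := hao.of_drazin h₁ h₂
    refine hP.isExtendable_of_right hB h2 hcB hecf (z := x * h) (by rw [← mul_assoc, hfx])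
      (by rw [mul_assoc, hho.mul_left, mul_zero])
      (by rw [mul_assoc, hho.mul_right, mul_zero]) ?_
      fun h0 => h₃ (by rw [mul_assoc, h0, mul_zero])
    calc x * h * (c * (x * h)) = x * (h * (c * x) * h) := by simp only [mul_assoc]
      _ = x * h := by rw [h₂]

theorem range_mulLeft_lt {F R : Type*} [Field F] [NonUnitalRing R] [Module F R]
    [SMulCommClass F R R] {k m : R} (hk : k * k = k) (hm : m * m = m) (hkm : k * m = 0)
    (hmk : m * k = 0) (h0 : m ≠ 0) :
    LinearMap.range (LinearMap.mulLeft F k) < LinearMap.range (LinearMap.mulLeft F (k + m)) := by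
  rw [SetLike.lt_iff_le_and_exists]
  refine ⟨?_, m, ⟨m, by simp [add_mul, hkm, hm]⟩, ?_⟩
  · rintro _ ⟨r, rfl⟩
    exact ⟨k * r, by simp [add_mul, mul_mul_eq_of_mul_eq hk, mul_mul_eq_of_mul_eq hmk]⟩
  · rintro ⟨r, hr⟩
    rw [LinearMap.mulLeft_apply] at hr
    apply h0
    rw [← hr, ← hk, mul_assoc, hr, hkm]

/-- A Jordan-Lie inner ideal of `[R, R]` is `eRf` modulo the radical for a pair of orthogonal
idempotents with `eRf ⊆ B`. -/
theorem IsJordanLie.exists_isStrictPairIn [FiniteDimensional F R]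
    (hB : IsJordanLie (lieDerived F R 1) B) (h2 : (2 : F) ≠ 0) :
    ∃ e f : R, IsStrictPairIn B e f ∧ ∀ b ∈ B, b - e * b * f ∈ radical R := by
  let S : Set (Submodule F R) :=
    {V | ∃ e f : R, IsStrictPairIn B e f ∧ V = LinearMap.range (LinearMap.mulLeft F (e + f))}
  have hS : S.Nonempty := by
    refine ⟨_, 0, 0, ⟨⟨?_, ?_, ?_, ?_⟩, ?_, Submodule.zero_mem _, Submodule.zero_mem _⟩, rfl⟩ <;>
      simp [IsIdempotentElem]
  obtain ⟨V, ⟨e, f, hP, rfl⟩, hmax⟩ :=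
    (wellFounded_gt (α := Submodule F R)).has_min S hS
  refine ⟨e, f, hP, fun b hb => by_contra fun hbr => ?_⟩
  obtain ⟨p, q, hP', hp, hq, hpp, hqq, hpq, hqp, hne⟩ := hP.isExtendable hB h2 hb hbr
  obtain ⟨hee, hff, hef, hfe⟩ := hP.orth
  refine hmax _ ⟨_, _, hP', rfl⟩ ?_
  rw [add_add_add_comm]
  refine range_mulLeft_lt ?_ ?_ ?_ ?_ ?_
  · simp [mul_add, add_mul, hee.eq, hff.eq, hef, hfe]
  · simp [mul_add, add_mul, hpp, hqq, hpq, hqp]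
  · simp [mul_add, add_mul, hp.left_mul, hp.right_mul, hq.left_mul, hq.right_mul]
  · simp [mul_add, add_mul, hp.mul_left, hp.mul_right, hq.mul_left, hq.mul_right]
  · intro h0
    have h1 : p = 0 := by simpa [mul_add, hpp, hpq] using congrArg (p * ·) h0
    have h3 : q = 0 := by simpa [mul_add, hqq, hqp] using congrArg (q * ·) h0
    exact hne.elim (· h1) (· h3)

theorem mem_sandwich {V : Submodule F R} {x : R} :
    x ∈ sandwich e V f ↔ ∃ v ∈ V, e * v * f = x := by
  simp [sandwich, Submodule.mem_map]

theorem isInnerIdeal_sandwich (h : IsOrthogonalIdempotentPair e f) :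
    IsInnerIdeal (lieDerived F R 1) (sandwich e (⊤ : Submodule F R) f) := by
  obtain ⟨hee, hff, hef, hfe⟩ := h
  constructor
  · intro x hx
    obtain ⟨v, -, rfl⟩ := mem_sandwich.1 hx
    exact mem_lieDerived_one' (e := e) (by simp only [← mul_assoc, hee.eq])
      (by rw [mul_assoc, hfe, mul_zero])
  · intro b hb b' hb' x _
    obtain ⟨v, -, rfl⟩ := mem_sandwich.1 hb
    obtain ⟨v', -, rfl⟩ := mem_sandwich.1 hb'
    refine mem_sandwich.2 ⟨-(v * f * x * e * v' + v' * f * x * e * v), trivial, ?_⟩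
    simp only [Ring.lie_def, mul_sub, sub_mul, mul_add, add_mul, mul_assoc, mul_neg, neg_mul,
      mul_mul_eq_of_mul_eq hfe, zero_mul, mul_zero]
    abel

/-- A bar-minimal Jordan-Lie inner ideal of `[R, R]` is of the form `eRf`. -/
theorem exists_eq_sandwich [FiniteDimensional F R] (hB : IsJordanLie (lieDerived F R 1) B)
    (hmin : IsBarMinimal (lieDerived F R 1) B) (h2 : (2 : F) ≠ 0) :
    ∃ e f : R, IsStrictPairIn B e f ∧ B = sandwich e (⊤ : Submodule F R) f := by
  obtain ⟨e, f, hP, hrad⟩ := hB.exists_isStrictPairIn h2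
  have hle : sandwich e (⊤ : Submodule F R) f ≤ B := fun x hx => by
    obtain ⟨v, -, rfl⟩ := mem_sandwich.1 hx
    exact hP.mem v
  refine ⟨e, f, hP, (hmin.2 _ (isInnerIdeal_sandwich hP.orth) hle ?_).symm⟩
  refine (Set.image_mono hle).antisymm ?_
  rintro _ ⟨b, hb, rfl⟩
  refine ⟨e * b * f, mem_sandwich.2 ⟨b, trivial, rfl⟩, ?_⟩
  exact ((RingCon.eq _).2 (((radical R).rel_iff _ _).2 (hrad b hb))).symm

theorem bar_mem_of_mem_idealSpan {A : Type*} [NonUnitalRing A] [Module F A] [IsScalarTower F A A]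
    [SMulCommClass F A A] {I : NonUnitalSubalgebra F A} {J : TwoSidedIdeal (Bar A)} {z f : I}
    (hz : z ∈ idealSpan F f) (hf : bar (f : A) ∈ J) : bar (z : A) ∈ J := by
  have hcfd : ∀ c d : I, bar ((c * f * d : I) : A) ∈ J := fun c d =>
    J.mul_mem_right _ (bar (d : A)) (J.mul_mem_left (bar (c : A)) _ hf)
  refine Submodule.closure_induction (p := fun z _ => bar ((z : I) : A) ∈ J) J.zero_mem
    (fun x y _ _ hx hy => J.add_mem hx hy) ?_ hz
  rintro r _ ⟨c, d, rfl⟩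
  rw [← smul_mul_assoc, ← smul_mul_assoc]
  exact hcfd _ _

end Main
end JLie

theorem theorem5p1 {F A : Type*} [Field F] [IsAlgClosed F] (hF : ringChar F ≠ 2)
    [NonUnitalRing A] [Module F A] [IsScalarTower F A A] [SMulCommClass F A A]
    [FiniteDimensional F A]
    (I : NonUnitalSubalgebra F A) (hI : JLie.IsAlgebraIdeal I)
    (B : Submodule F I)
    (hB : JLie.IsJordanLie (JLie.lieDerived F I 1) B)
    (hmin : JLie.IsBarMinimal (JLie.lieDerived F I 1) B) :
    ∃ e f : A, JLie.IsOrthogonalIdempotentPair e f ∧ JLie.IsStrict e f ∧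
      B.map (NonUnitalSubalgebraClass.subtype I : I →ₗ[F] A) = JLie.sandwich e ⊤ f ∧
      B.map (NonUnitalSubalgebraClass.subtype I : I →ₗ[F] A) =
        JLie.sandwich e I.toSubmodule f := by
  have : FiniteDimensional F I := inferInstanceAs (FiniteDimensional F I.toSubmodule)
  obtain ⟨e, f, hP, hBe⟩ := JLie.exists_eq_sandwich hB hmin (Ring.two_ne_zero hF)
  obtain ⟨hee, hff, hef, hfe⟩ := hP.orth
  have hmap : B.map (NonUnitalSubalgebraClass.subtype I : I →ₗ[F] A) =
      JLie.sandwich (e : A) I.toSubmodule (f : A) := by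
    ext x
    rw [JLie.mem_sandwich, Submodule.mem_map]
    constructor
    · rintro ⟨b, hb, rfl⟩
      rw [hBe] at hb
      obtain ⟨v, -, rfl⟩ := JLie.mem_sandwich.1 hb
      exact ⟨v, v.2, rfl⟩
    · rintro ⟨v, hv, rfl⟩
      exact ⟨e * ⟨v, hv⟩ * f, hP.mem _, rfl⟩
  have hee' : (e : A) * e = e := congrArg Subtype.val hee
  refine ⟨e, f, ⟨hee', congrArg Subtype.val hff, congrArg Subtype.val hef,
    congrArg Subtype.val hfe⟩, fun S _ => ?_, hmap.trans ?_, hmap⟩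
  · refine and_congr_right fun _ => ?_
    rw [sub_zero, sub_zero]
    exact ⟨JLie.bar_mem_of_mem_idealSpan hP.right, JLie.bar_mem_of_mem_idealSpan hP.left⟩
  · refine le_antisymm (Submodule.map_mono le_top) fun x hx => ?_
    obtain ⟨v, -, rfl⟩ := JLie.mem_sandwich.1 hx
    refine JLie.mem_sandwich.2 ⟨e * v, (hI v e e.2).2, ?_⟩
    rw [← mul_assoc, hee']
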